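/- Let $M^n$ be a connected smooth Riemannian manifold with Levi-Civita connection $\nabla$, and let $f\colon M^n\to\mathbb{R}^m$ be a smooth isometric immersion with normal bundle $N_fM$, normal connection $\nabla^\perp$ and second fundamental form $\alpha\colon TM\times TM\to N_fM$. Let $\tilde\nabla$ be the flat connection of $\mathbb{R}^m$, let $(\cdot)_{N_fM}$ be the orthogonal projection onto the normal space, and define the shape operators by $\langle A_\eta X,Y\rangle=\langle\alpha(X,Y),\eta\rangle$. Let $\mathcal{T}\colon M^n\to\mathbb{R}^m$ be an infinitesimal bending of $f$, that is, a smooth map with $$\langle\tilde\nabla_X\mathcal{T},f_*Y\rangle+\langle f_*X,\tilde\nabla_Y\mathcal{T}\rangle=0$$ for all tangent $X,Y$. Put $LX=\tilde\nabla_X\mathcal{T}$, let $\mathcal{Y}\eta\in TM$ be given by $\langle\mathcal{Y}\eta,X\rangle+\langle\eta,LX\rangle=0$ for all tangent $X$, and set $$\beta(X,Y)=\big(\tilde\nabla_X(LY)-L\nabla_XY\big)_{N_fM},\qquad \mathcal{E}(X,\eta)=\alpha(X,\mathcal{Y}\eta)+(LA_\eta X)_{N_fM}.$$ Then $\mathcal{T}$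 is trivial, that is, there are a skew-symmetric linear endomorphism $\mathcal{D}$ of $\mathbb{R}^m$ and $v\in\mathbb{R}^m$ with $\mathcal{T}=\mathcal{D}f+v$ on $M^n$, if and only if there is a smooth skew-symmetric section $C$ of $\mathrm{End}(N_fM)$ such that $$\beta(X,Y)=C\alpha(X,Y)\quad\text{and}\quad\mathcal{E}(X,\eta)=-(\nabla^\perp_XC)\eta$$ for all tangent vectors $X,Y$ and all smooth normal sections $\eta$, where $(\nabla^\perp_XC)\eta=\nabla^\perp_X(C\eta)-C\nabla^\perp_X\eta$. -/

import Mathlib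

open Bundle ContinuousLinearMap VectorField
open scoped Manifold ContDiff InnerProductSpace Topology

noncomputable section

namespace InfBending

/-! ### Calculus of vector-valued functions on a manifold

For `g : M → F`, `mvfderiv I g x : TangentSpace I x →L[ℝ] F` is the differential `g_*` of `g` at `x`.
It is also the flat derivative `∇̃` of `g`, seen as a section of a trivial bundle with fibre `F`. -/

section Calculus

variable {E : Type*} [NormedAddCommGroup E] [NormedSpace ℝ E]
  {H : Type*} [TopologicalSpace H] {I : ModelWithCorners ℝ E H}
  {M : Type*} [TopologicalSpace M] [ChartedSpace H M]
  {F : Type*} [NormedAddCommGroup F] [InnerProductSpace ℝ F]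

theorem mvfderiv_inner {a b : M → F} {x : M} (ha : MDiffAt a x) (hb : MDiffAt b x)
    (u : TangentSpace I x) :
    mvfderiv I (fun y ↦ ⟪a y, b y⟫_ℝ) x u =
      ⟪mvfderiv I a x u, b x⟫_ℝ + ⟪a x, mvfderiv I b x u⟫_ℝ := by
  have hs : UniqueDiffWithinAt ℝ (Set.range I) (extChartAt I x x) :=
    I.uniqueDiffOn _ (Set.mem_range_self _)
  have h := (ha.hasMFDerivAt.2.inner ℝ hb.hasMFDerivAt.2).fderivWithin hs
  have hab : MDiffAt (fun y ↦ ⟪a y, b y⟫_ℝ) x := by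
    refine (mdifferentiableAt_iff _ _).2 ⟨ha.continuousAt.inner hb.continuousAt, ?_⟩
    exact (ha.hasMFDerivAt.2.inner ℝ hb.hasMFDerivAt.2).differentiableWithinAt
  rw [hab.mvfderiv]
  have h' := congr($h u)
  have h0 : ∀ c : M → F, writtenInExtChartAt I 𝓘(ℝ, F) x c (extChartAt I x x) = c x := by
    intro c; simp [writtenInExtChartAt]; rfl
  refine h'.trans ((fderivInnerCLM_apply ℝ _ _).trans ?_)
  rw [add_comm, h0, h0]
  rfl

variable [IsManifold I ∞ M]

theorem mdiffAt_mvfderiv {g : M → F} (hg : ContMDiff I 𝓘(ℝ, F) ∞ g)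
    {Y : Π x : M, TangentSpace I x} {x : M} (hY : MDiffAt (T% Y) x) :
    MDiffAt (fun y ↦ mvfderiv I g y (Y y)) x := by
  have h1 : MDifferentiableAt I.tangent 𝓘(ℝ, F).tangent
      (tangentMap I 𝓘(ℝ, F) g) (⟨x, Y x⟩ : TangentBundle I M) :=
    (hg.contMDiff_tangentMap (m := 1) (by norm_cast)).mdifferentiableAt one_ne_zero
  have h2 := MDifferentiableAt.comp (I' := I.tangent) x h1 hY
  have h3 := (mdifferentiableAt_totalSpace _ _).1 h2
  convert! h3.2 using 1
  ext1 y
  simp [tangentMap, mvfderiv]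
  rfl

/-- Symmetry of second derivatives: `X(Y g) - Y(X g) = [X, Y] g`. -/
theorem mvfderiv_mvfderiv_sub [FiniteDimensional ℝ E] [I.Boundaryless] {g : M → F}
    (hg : ContMDiff I 𝓘(ℝ, F) ∞ g) {X Y : Π x : M, TangentSpace I x} {x : M}
    (hX : MDiffAt (T% X) x) (hY : MDiffAt (T% Y) x) :
    mvfderiv I (fun y ↦ mvfderiv I g y (Y y)) x (X x) -
      mvfderiv I (fun y ↦ mvfderiv I g y (X y)) x (Y x) = mvfderiv I g x (mlieBracket I X Y x) := by
  set φ := extChartAt I x with hφ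
  set z := φ x with hz
  have hnhds : φ.target ∈ 𝓝 z := extChartAt_target_mem_nhds x
  have hr : Set.range I ∈ 𝓝 z := Filter.mem_of_superset hnhds (extChartAt_target_subset_range x)
  set G : E → F := g ∘ φ.symm with hG
  have hGs : ∀ w ∈ φ.target, ContDiffAt ℝ ∞ G w := by
    intro w hw
    have h1 : ContMDiffAt 𝓘(ℝ, E) I ∞ φ.symm w :=
      (contMDiffOn_extChartAt_symm x).contMDiffAt ((isOpen_extChartAt_target x).mem_nhds hw)
    exact (hg.contMDiffAt.comp w h1).contDiffAt
  have hid : ∀ v : E, (ContinuousLinearMap.id ℝ E).inverse v = v := fun v ↦ by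
    rw [ContinuousLinearMap.inverse_id]; rfl
  let P (Z : Π x : M, TangentSpace I x) : E → E := mpullbackWithin 𝓘(ℝ, E) I φ.symm Z (Set.range I)
  have hP : ∀ Z : Π x : M, TangentSpace I x, MDiffAt (T% Z) x → DifferentiableAt ℝ (P Z) z := by
    intro Z hZ
    have := (hZ.mdifferentiableWithinAt
      (s := Set.univ)).differentiableWithinAt_mpullbackWithin_vectorField
    refine this.differentiableAt ?_
    rw [Set.preimage_univ, Set.univ_inter]; exact hr
  have hPz : ∀ Z : Π x : M, TangentSpace I x, P Z z = Z x := by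
    intro Z
    have h0 : φ.symm z = x := extChartAt_to_inv x
    have h1 : P Z z = (mfderivWithin 𝓘(ℝ, E) I φ.symm (Set.range I) z).inverse (Z (φ.symm z)) := rfl
    rw [h1, mfderivWithin_range_extChartAt_symm]
    exact (hid _).trans (by rw [h0])
  have key : ∀ Z : Π x : M, TangentSpace I x, MDiffAt (T% Z) x → ∀ u : E,
      mvfderiv I (fun y ↦ mvfderiv I g y (Z y)) x u =
        fderiv ℝ (fderiv ℝ G) z u (P Z z) + fderiv ℝ G z (fderiv ℝ (P Z) z u) := by
    intro Z hZ u
    rw [(mdiffAt_mvfderiv hg hZ).mvfderiv, fderivWithin_of_mem_nhds hr]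
    have heq : writtenInExtChartAt I 𝓘(ℝ, F) x (fun y ↦ mvfderiv I g y (Z y)) =ᶠ[𝓝 z]
        fun w ↦ fderiv ℝ G w (P Z w) := by
      filter_upwards [hnhds] with w hw
      have hd : MDifferentiableAt I 𝓘(ℝ, F) g (φ.symm w) :=
        hg.contMDiffAt.mdifferentiableAt (by simp)
      have hs : UniqueMDiffWithinAt 𝓘(ℝ, E) (Set.range I) w :=
        I.uniqueMDiffOn w (extChartAt_target_subset_range x hw)
      have h1 := mfderiv_comp_mfderivWithin w hd (mdifferentiableWithinAt_extChartAt_symm hw) hs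
      have hrw : Set.range I ∈ 𝓝 w := by rw [I.range_eq_univ]; exact Filter.univ_mem
      have h2 : fderiv ℝ G w = mfderivWithin 𝓘(ℝ, E) 𝓘(ℝ, F) G (Set.range I) w := by
        rw [mfderivWithin_eq_fderivWithin, fderivWithin_of_mem_nhds hrw]
      have h3 := (isInvertible_mfderivWithin_extChartAt_symm hw)
      change mfderiv I 𝓘(ℝ, F) g (φ.symm w) (Z (φ.symm w)) = fderiv ℝ G w
         ((mfderivWithin 𝓘(ℝ, E) I φ.symm (Set.range I) w).inverse (Z (φ.symm w)))
      rw [h2, h1]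
      have h4 := h3.self_apply_inverse (Z (φ.symm w))
      exact congrArg (mfderiv I 𝓘(ℝ, F) g (φ.symm w)) h4.symm
    rw [heq.fderiv_eq, fderiv_clm_apply _ (hP Z hZ)]
    · rw [add_comm]; rfl
    · exact ((hGs z (mem_extChartAt_target x)).fderiv_right (m := 1) (by norm_cast)).differentiableAt
        (by simp)
  have hbr : mvfderiv I g x (mlieBracket I X Y x) =
      fderiv ℝ G z (fderiv ℝ (P Y) z (P X z) - fderiv ℝ (P X) z (P Y z)) := by
    rw [← mlieBracketWithin_univ, mlieBracketWithin_apply, mfderiv_extChartAt_self,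
      (hg.mdifferentiableAt (by simp)).mvfderiv, fderivWithin_of_mem_nhds hr]
    refine (congrArg (fderiv ℝ G z) (hid _)).trans ?_
    have hr' : (extChartAt I x).symm ⁻¹' Set.univ ∩ Set.range I ∈ 𝓝 z := by
      rw [Set.preimage_univ, Set.univ_inter]; exact hr
    have hlb : lieBracketWithin ℝ (P X) (P Y)
        ((extChartAt I x).symm ⁻¹' Set.univ ∩ Set.range I) z =
          fderiv ℝ (P Y) z (P X z) - fderiv ℝ (P X) z (P Y z) := by
      rw [lieBracketWithin, fderivWithin_of_mem_nhds hr', fderivWithin_of_mem_nhds hr']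
    exact congrArg (fderiv ℝ G z) hlb
  have hsymm : IsSymmSndFDerivAt ℝ G z :=
    (hGs z (mem_extChartAt_target x)).isSymmSndFDerivAt (by simp; norm_cast)
  have e1 := key Y hY (X x)
  have e2 := key X hX (Y x)
  rw [hbr]
  refine (congrArg₂ (· - ·) e1 e2).trans ?_
  have e3 : fderiv ℝ (fderiv ℝ G) z (X x) (P Y z) = fderiv ℝ (fderiv ℝ G) z (Y x) (P X z) := by
    rw [hPz, hPz]; exact hsymm.eq _ _
  rw [e3, map_sub, hPz X, hPz Y]
  abel

end Calculus

/-! ### Isometric immersions -/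

section Normal

variable {E : Type*} [NormedAddCommGroup E] [NormedSpace ℝ E]
  {H : Type*} [TopologicalSpace H] (I : ModelWithCorners ℝ E H)
  {M : Type*} [TopologicalSpace M] [ChartedSpace H M]
  {F : Type*} [NormedAddCommGroup F] [InnerProductSpace ℝ F] [FiniteDimensional ℝ F]

/-- A smooth map `f : M → F` whose differential preserves inner products. -/
structure IsIsometricImmersion [RiemannianBundle (fun x : M ↦ TangentSpace I x)]
    (f : M → F) : Prop where
  contMDiff : ContMDiff I 𝓘(ℝ, F) ∞ f
  inner_map : ∀ (x : M) (u v : TangentSpace I x),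
    ⟪mvfderiv I f x u, mvfderiv I f x v⟫_ℝ = ⟪u, v⟫_ℝ

/-- The normal space `N_fM(x)`, the orthogonal complement of `f_* T_xM`. -/
def normalSpace (f : M → F) (x : M) : Submodule ℝ F := (mvfderiv I f x).rangeᗮ

/-- The normal component `w ↦ (w)_{N_fM}` at `x`. -/
def normalPart (f : M → F) (x : M) : F →L[ℝ] normalSpace I f x :=
  (normalSpace I f x).orthogonalProjectionOnto

theorem normalPart_mvfderiv (f : M → F) (x : M) (u : TangentSpace I x) :
    normalPart I f x (mvfderiv I f x u) = 0 := by
  refine Submodule.orthogonalProjectionOnto_apply_of_mem_orthogonal ?_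
  exact Submodule.le_orthogonal_orthogonal _ ⟨u, rfl⟩

/-- Smooth sections of the normal bundle. -/
def IsSmoothNormalSection (f : M → F) (η : Π x : M, normalSpace I f x) : Prop :=
  ContMDiff I 𝓘(ℝ, F) ∞ (fun x ↦ (η x : F))

/-- Smooth sections of `End(N_fM)`: the extension of `C` by zero on the tangent spaces is a
smooth map into the endomorphisms of the ambient space. -/
def IsSmoothNormalEnd (f : M → F) (C : Π x : M, normalSpace I f x →L[ℝ] normalSpace I f x) :
    Prop :=
  ContMDiff I 𝓘(ℝ, F →L[ℝ] F) ∞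
    (fun x ↦ (normalSpace I f x).subtypeL ∘L C x ∘L normalPart I f x)

/-- The normal connection: `normalConnection I f η x X` is `∇^⊥_X η` at `x`. -/
def normalConnection (f : M → F) (η : Π x : M, normalSpace I f x) (x : M) :
    TangentSpace I x →L[ℝ] normalSpace I f x :=
  normalPart I f x ∘L mvfderiv I (fun y ↦ (η y : F)) x

/-- `(∇^⊥_X C) η = ∇^⊥_X (C η) - C (∇^⊥_X η)` at `x`. -/
def normalConnectionEnd (f : M → F) (C : Π x : M, normalSpace I f x →L[ℝ] normalSpace I f x)
    (x : M) (X : TangentSpace I x) (η : Π x : M, normalSpace I f x) : normalSpace I f x :=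
  normalConnection I f (fun y ↦ C y (η y)) x X - C x (normalConnection I f η x X)

/-- `𝒯` is the restriction to `f` of a Killing field of the ambient space. -/
def IsTrivialBending {M F : Type*} [NormedAddCommGroup F] [InnerProductSpace ℝ F]
    (f 𝒯 : M → F) : Prop :=
  ∃ (D : F →ₗ[ℝ] F) (v : F), (∀ a b : F, ⟪D a, b⟫_ℝ = -⟪a, D b⟫_ℝ) ∧
    ∀ x, 𝒯 x = D (f x) + v

/-- Infinitesimal bendings: `⟨∇̃_X 𝒯, f_* Y⟩ + ⟨f_* X, ∇̃_Y 𝒯⟩ = 0`. -/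
structure IsInfinitesimalBending (f 𝒯 : M → F) : Prop where
  contMDiff : ContMDiff I 𝓘(ℝ, F) ∞ 𝒯
  inner_add_inner : ∀ (x : M) (X Y : TangentSpace I x),
    ⟪mvfderiv I 𝒯 x X, mvfderiv I f x Y⟫_ℝ + ⟪mvfderiv I f x X, mvfderiv I 𝒯 x Y⟫_ℝ = 0

end Normal

section Tensors

variable {E : Type*} [NormedAddCommGroup E] [NormedSpace ℝ E] [FiniteDimensional ℝ E]
  {H : Type*} [TopologicalSpace H] {I : ModelWithCorners ℝ E H}
  {M : Type*} [TopologicalSpace M] [ChartedSpace H M] [IsManifold I ∞ M]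
  [RiemannianBundle (fun x : M ↦ TangentSpace I x)]
  {F : Type*} [NormedAddCommGroup F] [InnerProductSpace ℝ F] [FiniteDimensional ℝ F]

instance instCompleteSpaceTangentSpace (x : M) : CompleteSpace (TangentSpace I x) :=
  have : FiniteDimensional ℝ (TangentSpace I x) := inferInstanceAs (FiniteDimensional ℝ E)
  FiniteDimensional.complete ℝ _

/-- The Levi-Civita connection `∇` of `M`. It is built from the immersion, through
`⟨∇_X Y, Z⟩ = ⟨∇̃_X f_* Y, f_* Z⟩`; the theorems `leviCivita_isMetricCompatible` and
`leviCivita_torsion` below show that it is the Levi-Civita connection of the metric of `M`.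
`leviCivita hf Y x X` is `∇_X Y` at `x`. -/
def leviCivita {f : M → F} (hf : IsIsometricImmersion I f) :
    CovariantDerivative I E (fun x : M ↦ TangentSpace I x) where
  toFun Y x := adjoint (mvfderiv I f x) ∘L mvfderiv I (fun y ↦ mvfderiv I f y (Y y)) x
  isCovariantDerivativeOnUniv :=
    { add := by
        intro Y Y' x hY hY' _
        have := mvfderiv_fun_add (mdiffAt_mvfderiv hf.contMDiff hY)
          (mdiffAt_mvfderiv hf.contMDiff hY')
        simp [this, ContinuousLinearMap.comp_add]
      leibniz := by
        intro Y g x hY hg _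
        have := mvfderiv_fun_smul hg (mdiffAt_mvfderiv hf.contMDiff hY)
        simp only [Pi.smul_apply', map_smul]
        ext1 u
        refine ext_inner_right ℝ fun v ↦ ?_
        simp [this, inner_add_left, adjoint_inner_left, inner_smul_left, hf.inner_map] }

theorem inner_leviCivita {f : M → F} (hf : IsIsometricImmersion I f)
    (Y : Π x : M, TangentSpace I x) (x : M) (u v : TangentSpace I x) :
    ⟪leviCivita hf Y x u, v⟫_ℝ =
      ⟪mvfderiv I (fun y ↦ mvfderiv I f y (Y y)) x u, mvfderiv I f x v⟫_ℝ := by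
  rw [← adjoint_inner_left]; rfl

theorem leviCivita_isMetricCompatible
    [IsContMDiffRiemannianBundle I ∞ E (fun x : M ↦ TangentSpace I x)]
    {f : M → F} (hf : IsIsometricImmersion I f) :
    (leviCivita hf).IsMetricCompatible (V := fun x : M ↦ TangentSpace I x) := by
  rw [CovariantDerivative.isMetricCompatible_iff]
  intro x X σ τ hX hσ hτ
  have h1 := inner_leviCivita hf σ x (X x) (τ x)
  have h2 := inner_leviCivita hf τ x (X x) (σ x)
  have := mvfderiv_inner (mdiffAt_mvfderiv hf.contMDiff hσ) (mdiffAt_mvfderiv hf.contMDiff hτ) (X x)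
  simp only [hf.inner_map] at this
  rw [real_inner_comm] at h2
  rw [real_inner_comm (mvfderiv I (fun y ↦ mvfderiv I f y (τ y)) x (X x)), ← h1, ← h2] at this
  exact this

theorem leviCivita_torsion [I.Boundaryless] {f : M → F} (hf : IsIsometricImmersion I f) :
    (leviCivita hf).torsion = 0 := by
  rw [CovariantDerivative.torsion_eq_zero_iff]
  intro X Y x hX hY
  refine ext_inner_right ℝ fun v ↦ ?_
  rw [inner_sub_left, inner_leviCivita, inner_leviCivita, ← inner_sub_left,
    mvfderiv_mvfderiv_sub hf.contMDiff hX hY, hf.inner_map]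

theorem tensorialAt_secondFundamentalForm {f : M → F} (hf : IsIsometricImmersion I f) (x : M) :
    TensorialAt I E (fun Y : Π x : M, TangentSpace I x ↦
      normalPart I f x ∘L mvfderiv I (fun y ↦ mvfderiv I f y (Y y)) x) x where
  smul := by
    intro g Y hg hY
    have := mvfderiv_fun_smul hg (mdiffAt_mvfderiv hf.contMDiff hY)
    simp only [Pi.smul_apply', map_smul]
    ext1 u
    simp [this, normalPart_mvfderiv]
  add := by
    intro Y Y' hY hY'
    have := mvfderiv_fun_add (mdiffAt_mvfderiv hf.contMDiff hY)
      (mdiffAt_mvfderiv hf.contMDiff hY')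
    simp [this, ContinuousLinearMap.comp_add]

/-- The second fundamental form `α(X, Y) = (∇̃_X f_* Y)_{N_fM}`. -/
def secondFundamentalForm {f : M → F} (hf : IsIsometricImmersion I f) (x : M) :
    TangentSpace I x →L[ℝ] TangentSpace I x →L[ℝ] normalSpace I f x :=
  (TensorialAt.mkHom _ x (tensorialAt_secondFundamentalForm hf x)).flip

theorem secondFundamentalForm_apply {f : M → F} (hf : IsIsometricImmersion I f) {x : M}
    (X : TangentSpace I x) {Y : Π x : M, TangentSpace I x} (hY : MDiffAt (T% Y) x) :
    secondFundamentalForm hf x X (Y x) =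
      normalPart I f x (mvfderiv I (fun y ↦ mvfderiv I f y (Y y)) x X) :=
  congr($(TensorialAt.mkHom_apply (tensorialAt_secondFundamentalForm hf x) hY) X)

/-- The shape operator: `⟨A_η X, Y⟩ = ⟨α(X, Y), η⟩`. -/
def shapeOperator {f : M → F} (hf : IsIsometricImmersion I f) (x : M)
    (η : normalSpace I f x) (X : TangentSpace I x) : TangentSpace I x :=
  adjoint (secondFundamentalForm hf x X) η

theorem inner_shapeOperator {f : M → F} (hf : IsIsometricImmersion I f) (x : M)
    (η : normalSpace I f x) (X Y : TangentSpace I x) :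
    ⟪shapeOperator hf x η X, Y⟫_ℝ = ⟪secondFundamentalForm hf x X Y, η⟫_ℝ := by
  rw [shapeOperator, adjoint_inner_left, real_inner_comm]

theorem tensorialAt_bendingB {f 𝒯 : M → F} (hf : IsIsometricImmersion I f)
    (h𝒯 : IsInfinitesimalBending I f 𝒯) (x : M) :
    TensorialAt I E (fun Y : Π x : M, TangentSpace I x ↦
      mvfderiv I (fun y ↦ mvfderiv I 𝒯 y (Y y)) x - mvfderiv I 𝒯 x ∘L leviCivita hf Y x) x where
  smul := by
    intro g Y hg hY
    have := mvfderiv_fun_smul hg (mdiffAt_mvfderiv h𝒯.contMDiff hY)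
    have h2 := (leviCivita hf).isCovariantDerivativeOnUniv.leibniz hY hg
    rw [show leviCivita hf (g • Y) x = _ from h2]
    simp only [Pi.smul_apply', map_smul]
    ext1 u
    simp [this, smul_sub]
  add := by
    intro Y Y' hY hY'
    have := mvfderiv_fun_add (mdiffAt_mvfderiv h𝒯.contMDiff hY)
      (mdiffAt_mvfderiv h𝒯.contMDiff hY')
    have h2 := (leviCivita hf).isCovariantDerivativeOnUniv.add hY hY'
    rw [show leviCivita hf (Y + Y') x = _ from h2]
    simp only [Pi.add_apply, map_add, this, ContinuousLinearMap.comp_add]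
    exact add_sub_add_comm ..

/-- The tensor `B(X, Y) = ∇̃_X (L Y) - L ∇_X Y`, where `L X = ∇̃_X 𝒯`. -/
def bendingB {f 𝒯 : M → F} (hf : IsIsometricImmersion I f)
    (h𝒯 : IsInfinitesimalBending I f 𝒯) (x : M) :
    TangentSpace I x →L[ℝ] TangentSpace I x →L[ℝ] F :=
  (TensorialAt.mkHom _ x (tensorialAt_bendingB hf h𝒯 x)).flip

theorem bendingB_apply {f 𝒯 : M → F} (hf : IsIsometricImmersion I f)
    (h𝒯 : IsInfinitesimalBending I f 𝒯) {x : M}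
    (X : TangentSpace I x) {Y : Π x : M, TangentSpace I x} (hY : MDiffAt (T% Y) x) :
    bendingB hf h𝒯 x X (Y x) = mvfderiv I (fun y ↦ mvfderiv I 𝒯 y (Y y)) x X -
      mvfderiv I 𝒯 x (leviCivita hf Y x X) :=
  congr($(TensorialAt.mkHom_apply (tensorialAt_bendingB hf h𝒯 x) hY) X)

/-- The tensor `β(X, Y) = (B(X, Y))_{N_fM}`. -/
def bendingBeta {f 𝒯 : M → F} (hf : IsIsometricImmersion I f)
    (h𝒯 : IsInfinitesimalBending I f 𝒯) (x : M) (X Y : TangentSpace I x) : normalSpace I f x :=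
  normalPart I f x (bendingB hf h𝒯 x X Y)

/-- The tensor `𝒴 : N_fM → TM` with `⟨𝒴 η, X⟩ + ⟨η, L X⟩ = 0`. -/
def bendingY (f 𝒯 : M → F) (x : M) (η : normalSpace I f x) : TangentSpace I x :=
  -adjoint (mvfderiv I 𝒯 x) (η : F)

theorem inner_bendingY (f 𝒯 : M → F) (x : M) (η : normalSpace I f x) (X : TangentSpace I x) :
    ⟪bendingY f 𝒯 x η, X⟫_ℝ + ⟪(η : F), mvfderiv I 𝒯 x X⟫_ℝ = 0 := by
  rw [bendingY, inner_neg_left, adjoint_inner_left, neg_add_cancel]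

/-- The tensor `ℰ(X, η) = α(X, 𝒴 η) + (L A_η X)_{N_fM}`. -/
def bendingE {f : M → F} (hf : IsIsometricImmersion I f) (𝒯 : M → F) (x : M)
    (X : TangentSpace I x) (η : normalSpace I f x) : normalSpace I f x :=
  secondFundamentalForm hf x X (bendingY f 𝒯 x η) +
    normalPart I f x (mvfderiv I 𝒯 x (shapeOperator hf x η X))

end Tensors

end InfBending

end

/-!
An infinitesimal bending `𝒯` and a skew-symmetric section `C` of `End(N_fM)` determine, at each
`x`, a skew-symmetric endomorphism `D` of the ambient space with `D f_* X = L X` and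
`D η = f_* 𝒴 η + C η`. Differentiating these two formulas along `M`, the Gauss and Weingarten
formulas give `(∇̃_X D) f_* Y = β(X, Y) - C α(X, Y)` and
`((∇̃_X D) η)_{N_fM} = ℰ(X, η) + (∇^⊥_X C) η`. The remaining part of `∇̃_X D` is controlled by its
skew-symmetry, so the two conditions on `C` say exactly that `D` is constant. Since `𝒯_* = D f_*`,
this amounts to `𝒯 - D f` being constant. Conversely, `𝒯 = D f + v` yields the constant
endomorphism `D` when `C` is the compression of `D` to the normal spaces.
-/

noncomputable section

namespace InfBending

section VectorValued

variable {𝕜 : Type*} [NontriviallyNormedField 𝕜]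
  {E : Type*} [NormedAddCommGroup E] [NormedSpace 𝕜 E]
  {H : Type*} [TopologicalSpace H] {I : ModelWithCorners 𝕜 E H}
  {M : Type*} [TopologicalSpace M] [ChartedSpace H M]
  {F : Type*} [NormedAddCommGroup F] [NormedSpace 𝕜 F]
  {G : Type*} [NormedAddCommGroup G] [NormedSpace 𝕜 G] {x : M}

theorem mvfderiv_clm_apply {D : M → F →L[𝕜] G} {w : M → F} (hD : MDiffAt D x) (hw : MDiffAt w x)
    (u : TangentSpace I x) :
    mvfderiv I (fun y ↦ D y (w y)) x u =
      D x (mvfderiv I w x u) + mvfderiv I D x u (w x) := by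
  have h : HasMFDerivAt I 𝓘(𝕜, G) (fun y ↦ D y (w y)) x
      (D x ∘L mvfderiv I w x + ContinuousLinearMap.apply 𝕜 G (w x) ∘L mvfderiv I D x) := by
    refine ⟨hD.continuousAt.clm_apply hw.continuousAt, ?_⟩
    convert! hD.hasMFDerivAt.2.clm_apply hw.hasMFDerivAt.2
    simp only [writtenInExtChartAt, Function.comp_apply, extChartAt_to_inv]
    rfl
  exact congr($(h.mfderiv) u)

theorem mvfderiv_clm_comp (L : F →L[𝕜] G) {w : M → F} (hw : MDiffAt w x) :
    mvfderiv I (fun y ↦ L (w y)) x = L ∘L mvfderiv I w x := by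
  ext u
  rw [mvfderiv_clm_apply mdifferentiableAt_const hw, mvfderiv_const]
  simp

theorem contMDiffAt_clm_of_apply [CompleteSpace 𝕜] [FiniteDimensional 𝕜 F] {n : ℕ∞ω}
    {D : M → F →L[𝕜] G} (h : ∀ w, CMDiffAt n (fun y ↦ D y w) x) : CMDiffAt n D x := by
  let b := Module.finBasis 𝕜 F
  have hD : D = fun y ↦ ∑ i, smulRightL 𝕜 F G (b.coord i).toContinuousLinearMap (D y (b i)) := by
    ext y w
    conv_lhs => rw [← b.sum_repr w, map_sum]
    simp
  rw [hD]
  exact contMDiffAt_finsetSum fun i _ ↦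
    (ContinuousLinearMap.contMDiffAt _).comp x (h (b i))

theorem contMDiffAt_mvfderiv {n m : ℕ∞ω} [IsManifold I n M] {g : M → F}
    (hg : ContMDiff I 𝓘(𝕜, F) n g) (hmn : m + 1 ≤ n) [IsManifold I 1 M]
    {Y : Π x : M, TangentSpace I x} (hY : CMDiffAt m (T% Y) x) :
    CMDiffAt m (fun y ↦ mvfderiv I g y (Y y)) x := by
  have h : CMDiffAt m (fun y ↦ tangentMap% g ⟨y, Y y⟩) x :=
    ((hg.contMDiff_tangentMap hmn).contMDiffAt (x := ⟨x, Y x⟩)).comp x hY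
  simpa only [trivializationAt_model_space_apply] using! (contMDiffAt_totalSpace.1 h).2

end VectorValued

section DerivativeVanishing

variable {E : Type*} [NormedAddCommGroup E] [NormedSpace ℝ E]
  {H : Type*} [TopologicalSpace H] {I : ModelWithCorners ℝ E H}
  {M : Type*} [TopologicalSpace M] [ChartedSpace H M]
  {F : Type*} [NormedAddCommGroup F]

theorem eventually_eq_of_mvfderiv_eq_zero [I.Boundaryless] [IsManifold I 1 M] [NormedSpace ℝ F]
    {g : M → F} (hg : MDiff g) (h : ∀ x, mvfderiv I g x = 0) (x : M) : ∀ᶠ y in 𝓝 x, g y = g x := by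
  set φ := extChartAt I x
  have hd : ∀ w ∈ φ.target, HasFDerivAt (g ∘ φ.symm) (0 : E →L[ℝ] F) w := by
    intro w hw
    have hφ : MDifferentiableAt 𝓘(ℝ, E) I φ.symm w := by
      simpa only [I.range_eq_univ, mdifferentiableWithinAt_univ] using
        mdifferentiableWithinAt_extChartAt_symm (I := I) hw
    have h0 : mfderiv I 𝓘(ℝ, F) g (φ.symm w) = 0 := h (φ.symm w)
    have hcomp := (hg (φ.symm w)).hasMFDerivAt.comp w hφ.hasMFDerivAt
    rw [h0] at hcomp
    exact HasMFDerivAt.hasFDerivAt (f' := (0 : E →L[ℝ] F)) (by convert! hcomp using 1)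
  have hopen := (isOpen_extChartAt_target (I := I) x).isOpen_inter_preimage_of_fderiv_eq_zero
    (𝕜 := ℝ) (fun w hw ↦ (hd w hw).differentiableAt.differentiableWithinAt)
    (fun w hw ↦ (hd w hw).fderiv) {g x}
  have hx : φ x ∈ φ.target ∩ (g ∘ φ.symm) ⁻¹' {g x} :=
    ⟨mem_extChartAt_target x, by simp [φ]⟩
  filter_upwards [(continuousAt_extChartAt (I := I) x).preimage_mem_nhds (hopen.mem_nhds hx),
    extChartAt_source_mem_nhds (I := I) x] with y hy hys
  exact (congrArg g (φ.left_inv hys)).symm.trans hy.2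

theorem eq_of_mvfderiv_eq_zero [I.Boundaryless] [IsManifold I 1 M] [PreconnectedSpace M]
    [NormedSpace ℝ F] {g : M → F} (hg : MDiff g) (h : ∀ x, mvfderiv I g x = 0) (x y : M) :
    g x = g y :=
  IsLocallyConstant.apply_eq_of_preconnectedSpace
    ((IsLocallyConstant.iff_eventually_eq g).2 (eventually_eq_of_mvfderiv_eq_zero hg h)) x y

theorem inner_mvfderiv_of_skew [InnerProductSpace ℝ F] {D : M → F →L[ℝ] F} {x : M}
    (hD : MDiffAt D x) (hskew : ∀ y a b, ⟪D y a, b⟫_ℝ = -⟪a, D y b⟫_ℝ) (u : TangentSpace I x)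
    (a b : F) : ⟪mvfderiv I D x u a, b⟫_ℝ = -⟪a, mvfderiv I D x u b⟫_ℝ := by
  let Λ : (F →L[ℝ] F) →L[ℝ] ℝ :=
    innerSL ℝ b ∘L ContinuousLinearMap.apply ℝ F a + innerSL ℝ a ∘L ContinuousLinearMap.apply ℝ F b
  have hΛ (L : F →L[ℝ] F) : Λ L = ⟪L a, b⟫_ℝ + ⟪a, L b⟫_ℝ :=
    congrArg (· + ⟪a, L b⟫_ℝ) (real_inner_comm (L a) b)
  have hΛD : (fun y ↦ Λ (D y)) = fun _ ↦ 0 := by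
    funext y
    rw [hΛ, hskew, neg_add_cancel]
  have hderiv : Λ (mvfderiv I D x u) = 0 := by
    rw [← comp_apply, ← mvfderiv_clm_comp Λ hD, hΛD, mvfderiv_const, zero_apply]
  rw [eq_neg_iff_add_eq_zero, ← hΛ, hderiv]

end DerivativeVanishing

section PositiveDefinite

variable {𝕜 E : Type*} [NontriviallyNormedField 𝕜] [CompleteSpace 𝕜]
  [NormedAddCommGroup E] [NormedSpace 𝕜 E] [FiniteDimensional 𝕜 E]

theorem isInvertible_of_apply_self_eq_zero {B : E →L[𝕜] E →L[𝕜] 𝕜} (hB : ∀ v, B v v = 0 → v = 0) :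
    B.IsInvertible := by
  have hinj : Function.Injective B :=
    (injective_iff_map_eq_zero B).2 fun v hv ↦ hB v congr($hv v)
  have hrank : Module.finrank 𝕜 E = Module.finrank 𝕜 (E →L[𝕜] 𝕜) := by
    rw [← (LinearMap.toContinuousLinearMap (𝕜 := 𝕜) (E := E) (F' := 𝕜)).finrank_eq]
    exact Subspace.dual_finrank_eq.symm
  exact ⟨(LinearEquiv.ofInjectiveOfFinrankEq B.toLinearMap hinj hrank).toContinuousLinearEquiv,
    rfl⟩

end PositiveDefinite

section Trivialization

variable {𝕜 : Type*} [NontriviallyNormedField 𝕜]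
  {EB : Type*} [NormedAddCommGroup EB] [NormedSpace 𝕜 EB]
  {HB : Type*} [TopologicalSpace HB] {IB : ModelWithCorners 𝕜 EB HB} {n : ℕ∞ω}
  {B : Type*} [TopologicalSpace B] [ChartedSpace HB B]
  {F : Type*} [NormedAddCommGroup F] [NormedSpace 𝕜 F]
  {V : B → Type*} [TopologicalSpace (TotalSpace F V)] [∀ x, TopologicalSpace (V x)]
  [∀ x, AddCommGroup (V x)] [∀ x, Module 𝕜 (V x)] [FiberBundle F V] [VectorBundle 𝕜 F V] {x : B}

theorem contMDiffAt_section_iff_continuousLinearMapAt {s : ∀ y, V y} :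
    CMDiffAt n (T% s) x ↔
      CMDiffAt n (fun y ↦ (trivializationAt F V x).continuousLinearMapAt 𝕜 y (s y)) x := by
  set e := trivializationAt F V x
  rw [contMDiffAt_section]
  refine Filter.EventuallyEq.contMDiffAt_iff ?_
  filter_upwards [e.open_baseSet.mem_nhds (FiberBundle.mem_baseSet_trivializationAt' x)] with y hy
  exact congrFun (e.coe_linearMapAt_of_mem (R := 𝕜) hy).symm (s y)

theorem contMDiffAt_symmL (v : F) :
    CMDiffAt n (T% fun y ↦ (trivializationAt F V x).symmL 𝕜 y v) x := by
  set e := trivializationAt F V x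
  rw [contMDiffAt_section_iff_continuousLinearMapAt]
  refine (contMDiffAt_const (c := v)).congr_of_eventuallyEq ?_
  filter_upwards [e.open_baseSet.mem_nhds (FiberBundle.mem_baseSet_trivializationAt' x)] with y hy
  exact e.continuousLinearMapAt_symmL hy v

end Trivialization

section Riesz

variable {EB : Type*} [NormedAddCommGroup EB] [NormedSpace ℝ EB]
  {HB : Type*} [TopologicalSpace HB] {IB : ModelWithCorners ℝ EB HB} {n : ℕ∞ω}
  {B : Type*} [TopologicalSpace B] [ChartedSpace HB B]
  {F : Type*} [NormedAddCommGroup F] [NormedSpace ℝ F]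
  {V : B → Type*} [TopologicalSpace (TotalSpace F V)] [∀ x, NormedAddCommGroup (V x)]
  [∀ x, InnerProductSpace ℝ (V x)] [FiberBundle F V] [VectorBundle ℝ F V] {x : B}

theorem contMDiffAt_section_of_inner [FiniteDimensional ℝ F] [ContMDiffVectorBundle n F V IB]
    [IsContMDiffRiemannianBundle IB n F V] {s : ∀ y, V y}
    (hs : ∀ t : ∀ y, V y, CMDiffAt n (T% t) x → CMDiffAt n (fun y ↦ ⟪s y, t y⟫_ℝ) x) :
    CMDiffAt n (T% s) x := by
  set e := trivializationAt F V x
  have hx : x ∈ e.baseSet := FiberBundle.mem_baseSet_trivializationAt' x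
  let gram (y : B) : F →L[ℝ] F →L[ℝ] ℝ := (innerSL ℝ).bilinearComp (e.symmL ℝ y) (e.symmL ℝ y)
  let dual (y : B) : F →L[ℝ] ℝ := innerSL ℝ (s y) ∘L e.symmL ℝ y
  have hgram : CMDiffAt n gram x := contMDiffAt_clm_of_apply fun v ↦
    contMDiffAt_clm_of_apply fun w ↦ (contMDiffAt_symmL v).inner_bundle (contMDiffAt_symmL w)
  have hdual : CMDiffAt n dual x := contMDiffAt_clm_of_apply fun w ↦ hs _ (contMDiffAt_symmL w)
  have hinv {y : B} (hy : y ∈ e.baseSet) : (gram y).IsInvertible :=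
    isInvertible_of_apply_self_eq_zero fun v hv ↦ by
      have h0 : e.symmL ℝ y v = 0 := inner_self_eq_zero.1 hv
      rw [← e.continuousLinearMapAt_symmL (R := ℝ) hy v, h0, map_zero]
  have hsmooth : CMDiffAt n (fun y ↦ (gram y).inverse (dual y)) x :=
    ((hinv hx).contDiffAt_map_inverse.comp_contMDiffAt hgram).clm_apply hdual
  rw [contMDiffAt_section_iff_continuousLinearMapAt]
  refine hsmooth.congr_of_eventuallyEq ?_
  filter_upwards [e.open_baseSet.mem_nhds hx] with y hy
  have hcoord : gram y (e.continuousLinearMapAt ℝ y (s y)) = dual y :=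
    congr(innerSL ℝ $(e.symmL_continuousLinearMapAt hy (s y)) ∘L e.symmL ℝ y)
  rw [← hcoord, (hinv hy).inverse_apply_self]

end Riesz

section VectorFieldExtension

variable {𝕜 : Type*} [NontriviallyNormedField 𝕜]
  {E : Type*} [NormedAddCommGroup E] [NormedSpace 𝕜 E]
  {H : Type*} [TopologicalSpace H] {I : ModelWithCorners 𝕜 E H}
  {M : Type*} [TopologicalSpace M] [ChartedSpace H M] [IsManifold I 1 M]

theorem exists_mdiffAt_vectorField_eq {x : M} (v : TangentSpace I x) :
    ∃ Y : Π y : M, TangentSpace I y, MDiffAt (T% Y) x ∧ Y x = v :=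
  ⟨FiberBundle.extend E v, FiberBundle.mdifferentiableAt_extend I E v, by simp⟩

end VectorFieldExtension

section AdjointDifferential

variable {E : Type*} [NormedAddCommGroup E] [NormedSpace ℝ E] [FiniteDimensional ℝ E]
  {H : Type*} [TopologicalSpace H] {I : ModelWithCorners ℝ E H}
  {M : Type*} [TopologicalSpace M] [ChartedSpace H M] [IsManifold I ∞ M]
  [RiemannianBundle (fun x : M ↦ TangentSpace I x)]
  [IsContMDiffRiemannianBundle I ∞ E (fun x : M ↦ TangentSpace I x)]
  {F : Type*} [NormedAddCommGroup F] [InnerProductSpace ℝ F] [CompleteSpace F]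

theorem contMDiffAt_adjoint_mvfderiv {g : M → F} (hg : ContMDiff I 𝓘(ℝ, F) ∞ g) {w : M → F}
    {x : M} (hw : CMDiffAt ∞ w x) :
    CMDiffAt ∞ (T% fun y ↦ adjoint (mvfderiv I g y) (w y)) x := by
  refine contMDiffAt_section_of_inner (V := fun y : M ↦ TangentSpace I y) fun t ht ↦ ?_
  simp only [adjoint_inner_left]
  exact contDiff_inner.contDiffAt.comp_contMDiffAt (𝕜 := ℝ)
    (hw.prodMk_space (contMDiffAt_mvfderiv hg (by norm_num) ht))

end AdjointDifferential

section NormalProjection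

variable {E : Type*} [NormedAddCommGroup E] [NormedSpace ℝ E]
  {H : Type*} [TopologicalSpace H] {I : ModelWithCorners ℝ E H}
  {M : Type*} [TopologicalSpace M] [ChartedSpace H M]
  {F : Type*} [NormedAddCommGroup F] [InnerProductSpace ℝ F] {f : M → F} {x : M}

theorem inner_mvfderiv_normal (u : TangentSpace I x) (η : normalSpace I f x) :
    ⟪mvfderiv I f x u, (η : F)⟫_ℝ = 0 :=
  (Submodule.mem_orthogonal _ _).1 η.2 _ ⟨u, rfl⟩

theorem inner_normal_mvfderiv (η : normalSpace I f x) (u : TangentSpace I x) :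
    ⟪(η : F), mvfderiv I f x u⟫_ℝ = 0 :=
  (Submodule.mem_orthogonal' _ _).1 η.2 _ ⟨u, rfl⟩

variable [FiniteDimensional ℝ F]

theorem normalPart_normal (η : normalSpace I f x) : normalPart I f x (η : F) = η :=
  Submodule.orthogonalProjectionOnto_mem_subspace_eq_self η

theorem inner_normalPart_left (w : F) (η : normalSpace I f x) :
    ⟪normalPart I f x w, η⟫_ℝ = ⟪w, (η : F)⟫_ℝ :=
  Submodule.inner_orthogonalProjectionOnto_eq_of_mem_right η w

theorem inner_normalPart_right (η : normalSpace I f x) (w : F) :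
    ⟪η, normalPart I f x w⟫_ℝ = ⟪(η : F), w⟫_ℝ :=
  Submodule.inner_orthogonalProjectionOnto_eq_of_mem_left η w

theorem exists_eq_mvfderiv_add_normal (I : ModelWithCorners ℝ E H) (f : M → F) (x : M) (w : F) :
    ∃ (u : TangentSpace I x) (η : normalSpace I f x), w = mvfderiv I f x u + η := by
  obtain ⟨_, ⟨u, rfl⟩, η, hη, hw⟩ := (mvfderiv I f x).range.exists_add_mem_mem_orthogonal w
  exact ⟨u, ⟨η, hη⟩, hw⟩

theorem clm_ext_of_tangent_normal {G : Type*} [NormedAddCommGroup G] [NormedSpace ℝ G]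
    {L L' : F →L[ℝ] G} (htan : ∀ u : TangentSpace I x, L (mvfderiv I f x u) = L' (mvfderiv I f x u))
    (hnor : ∀ η : normalSpace I f x, L η = L' η) : L = L' := by
  ext w
  obtain ⟨u, η, rfl⟩ := exists_eq_mvfderiv_add_normal I f x w
  rw [map_add, map_add, htan, hnor]

theorem eq_zero_of_inner_mvfderiv_of_normalPart {w : F}
    (htan : ∀ u : TangentSpace I x, ⟪w, mvfderiv I f x u⟫_ℝ = 0) (hnor : normalPart I f x w = 0) :
    w = 0 := by
  have hw : w ∈ normalSpace I f x := by
    rw [normalSpace, Submodule.mem_orthogonal']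
    rintro _ ⟨u, rfl⟩
    exact htan u
  simpa [hnor] using congr(($(normalPart_normal ⟨w, hw⟩) : F)).symm

end NormalProjection

section Isometric

variable {E : Type*} [NormedAddCommGroup E] [NormedSpace ℝ E] [FiniteDimensional ℝ E]
  {H : Type*} [TopologicalSpace H] {I : ModelWithCorners ℝ E H}
  {M : Type*} [TopologicalSpace M] [ChartedSpace H M]
  [RiemannianBundle (fun x : M ↦ TangentSpace I x)]
  {F : Type*} [NormedAddCommGroup F] [InnerProductSpace ℝ F] [FiniteDimensional ℝ F]
  {f : M → F} {x : M}

theorem adjoint_mvfderiv_normal (η : normalSpace I f x) :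
    adjoint (mvfderiv I f x) (η : F) = 0 := by
  refine ext_inner_right ℝ fun v ↦ ?_
  rw [adjoint_inner_left, inner_normal_mvfderiv, inner_zero_left]

theorem adjoint_mvfderiv_mvfderiv (hf : IsIsometricImmersion I f) (u : TangentSpace I x) :
    adjoint (mvfderiv I f x) (mvfderiv I f x u) = u := by
  refine ext_inner_right ℝ fun v ↦ ?_
  rw [adjoint_inner_left, hf.inner_map]

theorem mvfderiv_adjoint_add_normalPart (hf : IsIsometricImmersion I f) (x : M) (w : F) :
    mvfderiv I f x (adjoint (mvfderiv I f x) w) + (normalPart I f x w : F) = w := by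
  obtain ⟨u, η, rfl⟩ := exists_eq_mvfderiv_add_normal I f x w
  simp only [map_add, adjoint_mvfderiv_mvfderiv hf, adjoint_mvfderiv_normal, normalPart_mvfderiv,
    normalPart_normal, add_zero, zero_add]

theorem contMDiff_normalPart [IsManifold I ∞ M]
    [IsContMDiffRiemannianBundle I ∞ E (fun x : M ↦ TangentSpace I x)]
    (hf : IsIsometricImmersion I f) {w : M → F} (hw : ContMDiff I 𝓘(ℝ, F) ∞ w) :
    ContMDiff I 𝓘(ℝ, F) ∞ (fun y ↦ (normalPart I f y (w y) : F)) := by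
  have hnormal (y : M) : (normalPart I f y (w y) : F) =
      w y - mvfderiv I f y (adjoint (mvfderiv I f y) (w y)) :=
    eq_sub_of_add_eq' (mvfderiv_adjoint_add_normalPart hf y (w y))
  simp only [hnormal]
  exact hw.sub fun y ↦ contMDiffAt_mvfderiv hf.contMDiff (by norm_num)
    (contMDiffAt_adjoint_mvfderiv hf.contMDiff (hw y))

end Isometric

section GaussWeingarten

variable {E : Type*} [NormedAddCommGroup E] [NormedSpace ℝ E] [FiniteDimensional ℝ E]
  {H : Type*} [TopologicalSpace H] {I : ModelWithCorners ℝ E H}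
  {M : Type*} [TopologicalSpace M] [ChartedSpace H M] [IsManifold I ∞ M]
  [RiemannianBundle (fun x : M ↦ TangentSpace I x)]
  {F : Type*} [NormedAddCommGroup F] [InnerProductSpace ℝ F] [FiniteDimensional ℝ F]
  {f 𝒯 : M → F} {x : M}

theorem gauss_formula (hf : IsIsometricImmersion I f) (X : TangentSpace I x)
    {Y : Π x : M, TangentSpace I x} (hY : MDiffAt (T% Y) x) :
    mvfderiv I (fun y ↦ mvfderiv I f y (Y y)) x X =
      mvfderiv I f x (leviCivita hf Y x X) + (secondFundamentalForm hf x X (Y x) : F) := by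
  rw [secondFundamentalForm_apply hf X hY]
  exact (mvfderiv_adjoint_add_normalPart hf x _).symm

theorem adjoint_mvfderiv_normalSection (hf : IsIsometricImmersion I f) (X : TangentSpace I x)
    {η : Π x : M, normalSpace I f x} (hη : MDiffAt (fun y ↦ (η y : F)) x) :
    adjoint (mvfderiv I f x) (mvfderiv I (fun y ↦ (η y : F)) x X) =
      -shapeOperator hf x (η x) X := by
  refine ext_inner_right ℝ fun Z ↦ ?_
  obtain ⟨Z, hZ, rfl⟩ := exists_mdiffAt_vectorField_eq Z
  have hderiv := mvfderiv_inner hη (mdiffAt_mvfderiv hf.contMDiff hZ) X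
  simp only [inner_normal_mvfderiv, mvfderiv_const, zero_apply] at hderiv
  rw [gauss_formula hf X hZ, inner_add_right, inner_normal_mvfderiv, zero_add] at hderiv
  rw [adjoint_inner_left, inner_neg_left, inner_shapeOperator, Submodule.coe_inner,
    real_inner_comm (η x : F)]
  exact eq_neg_of_add_eq_zero_left hderiv.symm

theorem weingarten_formula (hf : IsIsometricImmersion I f) (X : TangentSpace I x)
    {η : Π x : M, normalSpace I f x} (hη : MDiffAt (fun y ↦ (η y : F)) x) :
    mvfderiv I (fun y ↦ (η y : F)) x X =
      -mvfderiv I f x (shapeOperator hf x (η x) X) + (normalConnection I f η x X : F) := by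
  rw [← map_neg, ← adjoint_mvfderiv_normalSection hf X hη]
  exact (mvfderiv_adjoint_add_normalPart hf x _).symm

theorem secondFundamentalForm_symm [I.Boundaryless] (hf : IsIsometricImmersion I f)
    (X Y : TangentSpace I x) :
    secondFundamentalForm hf x X Y = secondFundamentalForm hf x Y X := by
  obtain ⟨X, hX, rfl⟩ := exists_mdiffAt_vectorField_eq X
  obtain ⟨Y, hY, rfl⟩ := exists_mdiffAt_vectorField_eq Y
  rw [secondFundamentalForm_apply hf _ hY, secondFundamentalForm_apply hf _ hX, ← sub_eq_zero,
    ← map_sub, mvfderiv_mvfderiv_sub hf.contMDiff hX hY, normalPart_mvfderiv]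

theorem bendingB_symm [I.Boundaryless] (hf : IsIsometricImmersion I f)
    (h𝒯 : IsInfinitesimalBending I f 𝒯) (X Y : TangentSpace I x) :
    bendingB hf h𝒯 x X Y = bendingB hf h𝒯 x Y X := by
  obtain ⟨X, hX, rfl⟩ := exists_mdiffAt_vectorField_eq X
  obtain ⟨Y, hY, rfl⟩ := exists_mdiffAt_vectorField_eq Y
  have htorsion := (CovariantDerivative.torsion_eq_zero_iff _).1 (leviCivita_torsion hf) hX hY
  rw [bendingB_apply hf h𝒯 _ hY, bendingB_apply hf h𝒯 _ hX, ← sub_eq_zero, sub_sub_sub_comm,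
    mvfderiv_mvfderiv_sub h𝒯.contMDiff hX hY, ← map_sub, htorsion, sub_self]

theorem inner_bendingB_self (hf : IsIsometricImmersion I f) (h𝒯 : IsInfinitesimalBending I f 𝒯)
    (X Y : TangentSpace I x) :
    ⟪bendingB hf h𝒯 x X Y, mvfderiv I f x Y⟫_ℝ +
      ⟪(secondFundamentalForm hf x X Y : F), mvfderiv I 𝒯 x Y⟫_ℝ = 0 := by
  obtain ⟨Y, hY, rfl⟩ := exists_mdiffAt_vectorField_eq Y
  have horth (y : M) : ⟪mvfderiv I 𝒯 y (Y y), mvfderiv I f y (Y y)⟫_ℝ = 0 := by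
    have h := h𝒯.inner_add_inner y (Y y) (Y y)
    rwa [real_inner_comm (mvfderiv I 𝒯 y (Y y)), ← two_mul,
      mul_eq_zero_iff_left two_ne_zero] at h
  have hderiv := mvfderiv_inner (mdiffAt_mvfderiv h𝒯.contMDiff hY)
    (mdiffAt_mvfderiv hf.contMDiff hY) X
  simp only [horth, mvfderiv_const, zero_apply] at hderiv
  have hL := bendingB_apply hf h𝒯 X hY
  rw [eq_sub_iff_add_eq] at hL
  rw [← hL, gauss_formula hf X hY, inner_add_left, inner_add_right] at hderiv
  have hskew := h𝒯.inner_add_inner x (leviCivita hf Y x X) (Y x)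
  rw [real_inner_comm (mvfderiv I 𝒯 x (Y x))] at hskew
  rw [real_inner_comm (mvfderiv I 𝒯 x (Y x))]
  linarith

theorem eq_zero_of_symm_of_antisymm {V R : Type*} [AddCommGroup R] [IsAddTorsionFree R]
    {φ : V → V → V → R} (hsymm : ∀ x y z, φ x y z = φ y x z)
    (hanti : ∀ x y z, φ x y z = -φ x z y) (x y z : V) : φ x y z = 0 :=
  self_eq_neg.1 <| calc
    φ x y z = -φ z x y := by rw [hanti, hsymm]
    _ = φ y z x := by rw [hanti, neg_neg, hsymm]
    _ = -φ x y z := by rw [hanti, hsymm]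

theorem adjoint_bendingB [I.Boundaryless] (hf : IsIsometricImmersion I f)
    (h𝒯 : IsInfinitesimalBending I f 𝒯) (X Y : TangentSpace I x) :
    adjoint (mvfderiv I f x) (bendingB hf h𝒯 x X Y) =
      bendingY f 𝒯 x (secondFundamentalForm hf x X Y) := by
  let φ (X Y Z : TangentSpace I x) : ℝ := ⟪bendingB hf h𝒯 x X Y, mvfderiv I f x Z⟫_ℝ +
    ⟪(secondFundamentalForm hf x X Y : F), mvfderiv I 𝒯 x Z⟫_ℝ
  have hsymm (X Y Z) : φ X Y Z = φ Y X Z := by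
    simp only [φ, bendingB_symm hf h𝒯 X Y, secondFundamentalForm_symm hf X Y]
  have hanti (X Y Z) : φ X Y Z = -φ X Z Y := by
    have hpolar := inner_bendingB_self hf h𝒯 X (Y + Z)
    simp only [map_add, Submodule.coe_add, inner_add_left, inner_add_right] at hpolar
    have hY := inner_bendingB_self hf h𝒯 X Y
    have hZ := inner_bendingB_self hf h𝒯 X Z
    simp only [φ]
    linarith
  refine ext_inner_right ℝ fun Z ↦ ?_
  rw [adjoint_inner_left]
  have hφ := eq_zero_of_symm_of_antisymm hsymm hanti X Y Z
  have h𝒴 := inner_bendingY f 𝒯 x (secondFundamentalForm hf x X Y) Z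
  exact (eq_neg_of_add_eq_zero_left hφ).trans (eq_neg_of_add_eq_zero_left h𝒴).symm

end GaussWeingarten

section NormalCompression

variable {E : Type*} [NormedAddCommGroup E] [NormedSpace ℝ E]
  {H : Type*} [TopologicalSpace H] {I : ModelWithCorners ℝ E H}
  {M : Type*} [TopologicalSpace M] [ChartedSpace H M]
  {F : Type*} [NormedAddCommGroup F] [InnerProductSpace ℝ F] [FiniteDimensional ℝ F]
  {f : M → F}

/-- The compression `η ↦ (D η)_{N_fM}` of an ambient endomorphism `D` to the normal spaces of `f`.
For a trivial bending `𝒯 = D f + v` it is the section `C` of `End(N_fM)` in the theorem. -/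
def normalCompression (I : ModelWithCorners ℝ E H) (f : M → F) (D : F →L[ℝ] F) (x : M) :
    normalSpace I f x →L[ℝ] normalSpace I f x :=
  normalPart I f x ∘L D ∘L (normalSpace I f x).subtypeL

theorem inner_normalCompression {D : F →L[ℝ] F} (hD : ∀ a b, ⟪D a, b⟫_ℝ = -⟪a, D b⟫_ℝ) (x : M)
    (η ξ : normalSpace I f x) :
    ⟪normalCompression I f D x η, ξ⟫_ℝ = -⟪η, normalCompression I f D x ξ⟫_ℝ := by
  simp only [normalCompression, comp_apply, Submodule.subtypeL_apply, inner_normalPart_left,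
    inner_normalPart_right, hD]

theorem isSmoothNormalEnd_normalCompression [FiniteDimensional ℝ E] [IsManifold I ∞ M]
    [RiemannianBundle (fun x : M ↦ TangentSpace I x)]
    [IsContMDiffRiemannianBundle I ∞ E (fun x : M ↦ TangentSpace I x)]
    (hf : IsIsometricImmersion I f) (D : F →L[ℝ] F) :
    IsSmoothNormalEnd I f (normalCompression I f D) := fun x ↦
  contMDiffAt_clm_of_apply fun _ ↦
    contMDiff_normalPart hf (D.contMDiff.comp (contMDiff_normalPart hf contMDiff_const)) x

end NormalCompression

section TrivialBending

variable {E : Type*} [NormedAddCommGroup E] [NormedSpace ℝ E]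
  {H : Type*} [TopologicalSpace H] {I : ModelWithCorners ℝ E H} [I.Boundaryless]
  {M : Type*} [TopologicalSpace M] [ChartedSpace H M] [IsManifold I 1 M] [PreconnectedSpace M]
  {F : Type*} [NormedAddCommGroup F] [InnerProductSpace ℝ F] [FiniteDimensional ℝ F]
  {f 𝒯 : M → F}

theorem isTrivialBending_iff_exists_mvfderiv_eq_comp (hf : MDiff f) (h𝒯 : MDiff 𝒯) :
    IsTrivialBending f 𝒯 ↔ ∃ D : F →L[ℝ] F, (∀ a b, ⟪D a, b⟫_ℝ = -⟪a, D b⟫_ℝ) ∧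
      ∀ x, mvfderiv I 𝒯 x = D ∘L mvfderiv I f x := by
  have hDf (D : F →L[ℝ] F) : MDiff (fun y ↦ D (f y)) := fun y ↦ D.mdifferentiableAt.comp y (hf y)
  constructor
  · rintro ⟨D, v, hskew, h⟩
    refine ⟨D.toContinuousLinearMap, hskew, fun x ↦ ?_⟩
    have hadd := mvfderiv_fun_add (hDf D.toContinuousLinearMap x) (mdifferentiableAt_const (c := v))
    rw [mvfderiv_const, add_zero, mvfderiv_clm_comp _ (hf x)] at hadd
    rw [funext h]
    exact hadd
  · rintro ⟨D, hskew, h⟩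
    have hconst : ∀ x y, 𝒯 x - D (f x) = 𝒯 y - D (f y) :=
      eq_of_mvfderiv_eq_zero (I := I) (fun x ↦ (h𝒯 x).sub (hDf D x)) fun x ↦ by
        rw [mvfderiv_fun_sub (h𝒯 x) (hDf D x), mvfderiv_clm_comp D (hf x), h, sub_self]
    rcases isEmpty_or_nonempty M with _ | ⟨⟨o⟩⟩
    · exact ⟨D, 0, hskew, isEmptyElim⟩
    · exact ⟨D, 𝒯 o - D (f o), hskew, fun x ↦ eq_add_of_sub_eq' (hconst x o)⟩

end TrivialBending

section AmbientEnd

variable {E : Type*} [NormedAddCommGroup E] [NormedSpace ℝ E] [FiniteDimensional ℝ E]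
  {H : Type*} [TopologicalSpace H] {I : ModelWithCorners ℝ E H}
  {M : Type*} [TopologicalSpace M] [ChartedSpace H M]
  [RiemannianBundle (fun x : M ↦ TangentSpace I x)]
  {F : Type*} [NormedAddCommGroup F] [InnerProductSpace ℝ F] [FiniteDimensional ℝ F]
  {f 𝒯 : M → F} {C : Π x : M, normalSpace I f x →L[ℝ] normalSpace I f x} {x : M}

/-- The endomorphism `D_x` of the ambient space that extends `L : f_* X ↦ ∇̃_X 𝒯` by
`η ↦ f_* 𝒴 η + C η` on the normal space. It is the velocity of the ambient rotation which the
bending `𝒯`, together with the rotation `C` of the normal bundle, prescribes at `x`. -/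
def ambientEnd (f 𝒯 : M → F) (C : Π x : M, normalSpace I f x →L[ℝ] normalSpace I f x) (x : M) :
    F →L[ℝ] F :=
  mvfderiv I 𝒯 x ∘L adjoint (mvfderiv I f x) +
    ((normalSpace I f x).subtypeL ∘L C x ∘L normalPart I f x -
      mvfderiv I f x ∘L adjoint (mvfderiv I 𝒯 x) ∘L (normalSpace I f x).subtypeL ∘L
        normalPart I f x)

theorem ambientEnd_mvfderiv (hf : IsIsometricImmersion I f) (u : TangentSpace I x) :
    ambientEnd f 𝒯 C x (mvfderiv I f x u) = mvfderiv I 𝒯 x u := by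
  simp [ambientEnd, adjoint_mvfderiv_mvfderiv hf, normalPart_mvfderiv]

theorem ambientEnd_normal (η : normalSpace I f x) :
    ambientEnd f 𝒯 C x η = mvfderiv I f x (bendingY f 𝒯 x η) + (C x η : F) := by
  simp only [ambientEnd, bendingY, add_apply, sub_apply, comp_apply, Submodule.subtypeL_apply,
    adjoint_mvfderiv_normal, normalPart_normal, map_zero, map_neg]
  abel

variable [IsManifold I ∞ M]

theorem inner_ambientEnd (hf : IsIsometricImmersion I f) (h𝒯 : IsInfinitesimalBending I f 𝒯)
    (hC : ∀ η ξ, ⟪C x η, ξ⟫_ℝ = -⟪η, C x ξ⟫_ℝ) (a b : F) :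
    ⟪ambientEnd f 𝒯 C x a, b⟫_ℝ = -⟪a, ambientEnd f 𝒯 C x b⟫_ℝ := by
  obtain ⟨u, η, rfl⟩ := exists_eq_mvfderiv_add_normal I f x a
  obtain ⟨v, ξ, rfl⟩ := exists_eq_mvfderiv_add_normal I f x b
  have huv := h𝒯.inner_add_inner x u v
  have hηv := inner_bendingY f 𝒯 x η v
  have hξu := inner_bendingY f 𝒯 x ξ u
  have hηξ := hC η ξ
  rw [real_inner_comm, real_inner_comm _ (ξ : F)] at hξu
  simp only [map_add, ambientEnd_mvfderiv hf, ambientEnd_normal, inner_add_left, inner_add_right,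
    hf.inner_map, inner_mvfderiv_normal, inner_normal_mvfderiv, ← Submodule.coe_inner]
  linarith

theorem ambientEnd_normalCompression (hf : IsIsometricImmersion I f) {D : F →L[ℝ] F}
    (hD : ∀ a b, ⟪D a, b⟫_ℝ = -⟪a, D b⟫_ℝ) (h𝒯 : mvfderiv I 𝒯 x = D ∘L mvfderiv I f x) :
    ambientEnd f 𝒯 (normalCompression I f D) x = D := by
  refine clm_ext_of_tangent_normal (I := I) (f := f) (x := x) (fun u ↦ ?_) fun η ↦ ?_
  · rw [ambientEnd_mvfderiv hf, h𝒯, comp_apply]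
  · have h𝒴 : bendingY f 𝒯 x η = adjoint (mvfderiv I f x) (D η) := by
      refine ext_inner_right ℝ fun u ↦ ?_
      rw [eq_neg_of_add_eq_zero_left (inner_bendingY f 𝒯 x η u), h𝒯, comp_apply, ← hD,
        adjoint_inner_left]
    rw [ambientEnd_normal, h𝒴]
    exact mvfderiv_adjoint_add_normalPart hf x (D η)

theorem contMDiffAt_bendingY
    [IsContMDiffRiemannianBundle I ∞ E (fun x : M ↦ TangentSpace I x)]
    (h𝒯 : ContMDiff I 𝓘(ℝ, F) ∞ 𝒯) {η : Π x : M, normalSpace I f x}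
    (hη : CMDiffAt ∞ (fun y ↦ (η y : F)) x) :
    CMDiffAt ∞ (T% fun y ↦ bendingY f 𝒯 y (η y)) x := by
  simpa only [bendingY, map_neg] using contMDiffAt_adjoint_mvfderiv h𝒯 hη.neg

theorem contMDiff_ambientEnd
    [IsContMDiffRiemannianBundle I ∞ E (fun x : M ↦ TangentSpace I x)]
    (hf : IsIsometricImmersion I f) (h𝒯 : ContMDiff I 𝓘(ℝ, F) ∞ 𝒯)
    (hC : IsSmoothNormalEnd I f C) : ContMDiff I 𝓘(ℝ, F →L[ℝ] F) ∞ (ambientEnd f 𝒯 C) := by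
  refine fun x ↦ .add ?_ ((hC x).sub ?_) <;> refine contMDiffAt_clm_of_apply fun w ↦ ?_
  · exact contMDiffAt_mvfderiv h𝒯 (by norm_num)
      (contMDiffAt_adjoint_mvfderiv hf.contMDiff contMDiffAt_const)
  · exact contMDiffAt_mvfderiv hf.contMDiff (by norm_num)
      (contMDiffAt_adjoint_mvfderiv h𝒯 (contMDiff_normalPart hf contMDiff_const x))

theorem mvfderiv_ambientEnd_mvfderiv [I.Boundaryless] (hf : IsIsometricImmersion I f)
    (h𝒯 : IsInfinitesimalBending I f 𝒯) (hD : MDiffAt (ambientEnd f 𝒯 C) x)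
    (X Y : TangentSpace I x) :
    mvfderiv I (ambientEnd f 𝒯 C) x X (mvfderiv I f x Y) =
      (bendingBeta hf h𝒯 x X Y - C x (secondFundamentalForm hf x X Y) : normalSpace I f x) := by
  obtain ⟨Y, hY, rfl⟩ := exists_mdiffAt_vectorField_eq Y
  have hprod := mvfderiv_clm_apply hD (mdiffAt_mvfderiv hf.contMDiff hY) X
  simp only [ambientEnd_mvfderiv hf] at hprod
  rw [gauss_formula hf X hY, map_add, ambientEnd_mvfderiv hf, ambientEnd_normal] at hprod
  have hB := mvfderiv_adjoint_add_normalPart hf x (bendingB hf h𝒯 x X (Y x))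
  rw [adjoint_bendingB hf h𝒯, bendingB_apply hf h𝒯 X hY, hprod] at hB
  rw [bendingBeta, bendingB_apply hf h𝒯 X hY, hprod, Submodule.coe_sub, eq_sub_iff_add_eq]
  refine add_left_cancel (hB.trans ?_).symm
  abel

theorem normalPart_mvfderiv_ambientEnd
    [IsContMDiffRiemannianBundle I ∞ E (fun x : M ↦ TangentSpace I x)]
    (hf : IsIsometricImmersion I f) (h𝒯 : ContMDiff I 𝓘(ℝ, F) ∞ 𝒯)
    (hC : IsSmoothNormalEnd I f C) (hD : MDiffAt (ambientEnd f 𝒯 C) x)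
    (X : TangentSpace I x) {η : Π x : M, normalSpace I f x} (hη : IsSmoothNormalSection I f η) :
    normalPart I f x (mvfderiv I (ambientEnd f 𝒯 C) x X (η x)) =
      bendingE hf 𝒯 x X (η x) + normalConnectionEnd I f C x X η := by
  have hηd : MDiffAt (fun y ↦ (η y : F)) x := hη.mdifferentiableAt (by simp)
  have h𝒴η := (contMDiffAt_bendingY h𝒯 (hη x)).mdifferentiableAt (by simp)
  have hCη : MDiffAt (fun y ↦ (C y (η y) : F)) x := by
    simpa [normalPart_normal] using (hC.clm_apply hη).mdifferentiableAt (x := x) (by simp)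
  have hprod := congr(normalPart I f x $(mvfderiv_clm_apply hD hηd X))
  simp only [ambientEnd_normal] at hprod
  rw [mvfderiv_fun_add (mdiffAt_mvfderiv hf.contMDiff h𝒴η) hCη, add_apply,
    weingarten_formula hf X hηd] at hprod
  simp only [map_add, map_neg, ambientEnd_mvfderiv hf, ambientEnd_normal, normalPart_mvfderiv,
    normalPart_normal, zero_add] at hprod
  rw [← secondFundamentalForm_apply hf X h𝒴η, neg_add_eq_sub, sub_add_eq_add_sub,
    eq_sub_iff_add_eq] at hprod
  rw [bendingE, normalConnectionEnd, ← add_sub_assoc, eq_sub_iff_add_eq, add_right_comm,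
    add_comm _ (C x _)]
  exact hprod.symm

theorem mvfderiv_ambientEnd_eq_zero_iff [I.Boundaryless]
    [IsContMDiffRiemannianBundle I ∞ E (fun x : M ↦ TangentSpace I x)]
    (hf : IsIsometricImmersion I f) (h𝒯 : IsInfinitesimalBending I f 𝒯)
    (hC : IsSmoothNormalEnd I f C) (hskew : ∀ x η ξ, ⟪C x η, ξ⟫_ℝ = -⟪η, C x ξ⟫_ℝ) :
    mvfderiv I (ambientEnd f 𝒯 C) x = 0 ↔
      (∀ X Y : TangentSpace I x,
        bendingBeta hf h𝒯 x X Y = C x (secondFundamentalForm hf x X Y)) ∧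
      ∀ (X : TangentSpace I x) (η : Π x : M, normalSpace I f x),
        IsSmoothNormalSection I f η →
          bendingE hf 𝒯 x X (η x) = -normalConnectionEnd I f C x X η := by
  have hD : MDiffAt (ambientEnd f 𝒯 C) x :=
    (contMDiff_ambientEnd hf h𝒯.contMDiff hC).mdifferentiableAt (by simp)
  simp_rw [eq_neg_iff_add_eq_zero, ← sub_eq_zero (b := C x _)]
  refine ⟨fun h ↦ ⟨fun X Y ↦ ?_, fun X η hη ↦ ?_⟩, fun ⟨hβ, hE⟩ ↦ ?_⟩
  · rw [← Submodule.coe_eq_zero, ← mvfderiv_ambientEnd_mvfderiv hf h𝒯 hD, h, zero_apply, zero_apply]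
  · rw [← normalPart_mvfderiv_ambientEnd hf h𝒯.contMDiff hC hD X hη, h, zero_apply, zero_apply,
      map_zero]
  ext1 X
  have htan (Y : TangentSpace I x) : mvfderiv I (ambientEnd f 𝒯 C) x X (mvfderiv I f x Y) = 0 := by
    rw [mvfderiv_ambientEnd_mvfderiv hf h𝒯 hD, hβ, Submodule.coe_zero]
  refine clm_ext_of_tangent_normal htan fun ν ↦ ?_
  refine eq_zero_of_inner_mvfderiv_of_normalPart (I := I) (f := f) (x := x) (fun u ↦ ?_) ?_
  · rw [inner_mvfderiv_of_skew hD fun y ↦ inner_ambientEnd hf h𝒯 (hskew y), htan, inner_zero_right,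
      neg_zero]
  · have hν : IsSmoothNormalSection I f fun y ↦ normalPart I f y (ν : F) :=
      contMDiff_normalPart hf contMDiff_const
    have hzero := normalPart_mvfderiv_ambientEnd hf h𝒯.contMDiff hC hD X hν
    rwa [hE X _ hν, normalPart_normal] at hzero

theorem isTrivialBending_iff_exists_mvfderiv_ambientEnd_eq_zero [I.Boundaryless]
    [PreconnectedSpace M] [IsContMDiffRiemannianBundle I ∞ E (fun x : M ↦ TangentSpace I x)]
    (hf : IsIsometricImmersion I f) (h𝒯 : IsInfinitesimalBending I f 𝒯) :
    IsTrivialBending f 𝒯 ↔ ∃ C : Π x : M, normalSpace I f x →L[ℝ] normalSpace I f x,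
      IsSmoothNormalEnd I f C ∧ (∀ x η ξ, ⟪C x η, ξ⟫_ℝ = -⟪η, C x ξ⟫_ℝ) ∧
        ∀ x, mvfderiv I (ambientEnd f 𝒯 C) x = 0 := by
  have : IsManifold I 1 M := .of_le (n := ∞) (by norm_cast)
  rw [isTrivialBending_iff_exists_mvfderiv_eq_comp (I := I)
    (hf.contMDiff.mdifferentiable (by simp)) (h𝒯.contMDiff.mdifferentiable (by simp))]
  constructor
  · rintro ⟨D, hskew, hD⟩
    refine ⟨normalCompression I f D, isSmoothNormalEnd_normalCompression hf D,
      inner_normalCompression hskew, fun x ↦ ?_⟩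
    have hconst : ambientEnd f 𝒯 (normalCompression I f D) = fun _ ↦ D :=
      funext fun y ↦ ambientEnd_normalCompression hf hskew (hD y)
    rw [hconst, mvfderiv_const]
  · rintro ⟨C, hC, hskew, hconst⟩
    have hD : MDiff (ambientEnd f 𝒯 C) :=
      (contMDiff_ambientEnd hf h𝒯.contMDiff hC).mdifferentiable (by simp)
    rcases isEmpty_or_nonempty M with _ | ⟨⟨o⟩⟩
    · exact ⟨0, by simp, isEmptyElim⟩
    refine ⟨ambientEnd f 𝒯 C o, inner_ambientEnd hf h𝒯 (hskew o), fun x ↦ ?_⟩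
    ext1 u
    rw [eq_of_mvfderiv_eq_zero hD hconst o x, comp_apply, ambientEnd_mvfderiv hf]

end AmbientEnd

end InfBending

end

theorem mainTheorem6_general {E : Type*} [NormedAddCommGroup E] [NormedSpace ℝ E]
    [FiniteDimensional ℝ E] {H : Type*} [TopologicalSpace H] {I : ModelWithCorners ℝ E H}
    [I.Boundaryless] {M : Type*} [TopologicalSpace M] [PreconnectedSpace M] [ChartedSpace H M]
    [IsManifold I ∞ M] [RiemannianBundle (fun x : M ↦ TangentSpace I x)]
    [IsContMDiffRiemannianBundle I ∞ E (fun x : M ↦ TangentSpace I x)]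
    {F : Type*} [NormedAddCommGroup F] [InnerProductSpace ℝ F] [FiniteDimensional ℝ F]
    {f 𝒯 : M → F} (hf : InfBending.IsIsometricImmersion I f)
    (h𝒯 : InfBending.IsInfinitesimalBending I f 𝒯) :
    InfBending.IsTrivialBending f 𝒯 ↔
      ∃ C : Π x : M, InfBending.normalSpace I f x →L[ℝ] InfBending.normalSpace I f x,
        InfBending.IsSmoothNormalEnd I f C ∧
        (∀ (x : M) (η ξ : InfBending.normalSpace I f x), ⟪C x η, ξ⟫_ℝ = -⟪η, C x ξ⟫_ℝ) ∧
        (∀ (x : M) (X Y : TangentSpace I x),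
          InfBending.bendingBeta hf h𝒯 x X Y =
            C x (InfBending.secondFundamentalForm hf x X Y)) ∧
        (∀ (x : M) (X : TangentSpace I x) (η : Π x : M, InfBending.normalSpace I f x),
          InfBending.IsSmoothNormalSection I f η →
            InfBending.bendingE hf 𝒯 x X (η x) =
              -InfBending.normalConnectionEnd I f C x X η) := by
  rw [InfBending.isTrivialBending_iff_exists_mvfderiv_ambientEnd_eq_zero hf h𝒯]
  refine exists_congr fun C ↦ and_congr_right fun hC ↦ and_congr_right fun hskew ↦ ?_
  simp only [InfBending.mvfderiv_ambientEnd_eq_zero_iff hf h𝒯 hC hskew, forall_and]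

theorem mainTheorem6 {n m : ℕ} {M : Type*} [TopologicalSpace M] [T2Space M]
    [SecondCountableTopology M] [ConnectedSpace M]
    [ChartedSpace (EuclideanSpace ℝ (Fin n)) M] [IsManifold (𝓡 n) ∞ M]
    [RiemannianBundle (fun x : M ↦ TangentSpace (𝓡 n) x)]
    [IsContMDiffRiemannianBundle (𝓡 n) ∞ (EuclideanSpace ℝ (Fin n))
      (fun x : M ↦ TangentSpace (𝓡 n) x)]
    (f : M → EuclideanSpace ℝ (Fin m)) (hf : InfBending.IsIsometricImmersion (𝓡 n) f)
    (𝒯 : M → EuclideanSpace ℝ (Fin m)) (h𝒯 : InfBending.IsInfinitesimalBending (𝓡 n) f 𝒯) :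
    InfBending.IsTrivialBending f 𝒯 ↔
      ∃ C : Π x : M,
          InfBending.normalSpace (𝓡 n) f x →L[ℝ] InfBending.normalSpace (𝓡 n) f x,
        InfBending.IsSmoothNormalEnd (𝓡 n) f C ∧
        (∀ (x : M) (η ξ : InfBending.normalSpace (𝓡 n) f x), ⟪C x η, ξ⟫_ℝ = -⟪η, C x ξ⟫_ℝ) ∧
        (∀ (x : M) (X Y : TangentSpace (𝓡 n) x),
          InfBending.bendingBeta hf h𝒯 x X Y =
            C x (InfBending.secondFundamentalForm hf x X Y)) ∧
        (∀ (x : M) (X : TangentSpace (𝓡 n) x) (η : Π x : M, InfBending.normalSpace (𝓡 n) f x),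
          InfBending.IsSmoothNormalSection (𝓡 n) f η →
            InfBending.bendingE hf 𝒯 x X (η x) =
              -InfBending.normalConnectionEnd (𝓡 n) f C x X η) :=
  mainTheorem6_general hf h𝒯
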